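/- Let $p$ be a prime power. For every non-empty $\mathcal U\subseteq\{1,2,3,4\}$ let the key $s_{\mathcal U}$ consist of a non-negative integer number $L_{\mathcal U}$ of symbols of $\mathbb F_p$, where all symbols of all keys are independent and uniform, so that $H(s_{\mathcal U})=L_{\mathcal U}\log_2 p$ bits. Put $z_k=(s_{\mathcal U}:k\in\mathcal U)$ for $k=1,2,3,4$, and let $Z_k$ be the sequence of the values of $z_k$ in $L$ i.i.d. blocks of the keys. (Combinatorial secure groupcast to the first $2$ of $4$ receivers.) For each $L\ge 1$ a scheme sends a message $W$ of $L_W$ i.i.d. uniform symbols of a finite field $\mathbb F_{p'}$, independent of the keys, by broadcasting a signal $X$ of $L_X$ symbols of $\mathbb F_{p'}$, produced (possibly with randomization) from $W$ and the keys; Receiver $k$ sees $(X,Z_k)$. Its rate is $L_W\log_2 p'/L$ and its broadcast bandwidth is $L_X\log_2 p'/L$. The field may be chosen anew for each $L$, with size $p'$ in a given set $Q$ of integers that contains $p$ (for instance $Q=\{p\}$, or all prime powers). A sequence of schemes, one for each $L$, is admissible if Receivers 1 and 2 decode $W$, i.e. their error probabilities tend to $0$ (or, in the other form of the requirement, $H(W|X,Z_k)=o(L)$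 for $k=1,2$), and if $I(W;X,Z_k)=o(L)$ for $k=3,4$. A rate $R$ is achievable if some admissible sequence has all rates at least $R$; the capacity $C$ is the supremum of the achievable rates. The minimum broadcast bandwidth $\beta^*(R)$ is the infimum of all $\beta$ for which some admissible sequence has all rates at least $R$ and all broadcast bandwidths at most $\beta$. Then, for either form of the decoding requirement and every such $Q$, the capacity is $$C=\min_{q\in\{1,2\},\,e\in\{3,4\}}H(z_q|z_e)=H(s_{12})+\min\bigl(H(s_1)+H(s_{14})+H(s_{124}),\;H(s_1)+H(s_{13})+H(s_{123}),\;H(s_2)+H(s_{24})+H(s_{124}),\;H(s_2)+H(s_{23})+H(s_{123})\bigr),$$ and the minimum broadcast bandwidth at capacity is $$\beta^*(C)=2C-H(s_{12})-\min\bigl(H(s_{123}),H(s_{124})\bigr).$$ -/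

import Mathlib

noncomputable section

/-! ### Shannon entropy of finite-valued random variables, in bits -/

/-- Entropy `H(f)` of the random variable `f` on the discrete probability space `P`. -/
def entropy {Ω α : Type*} [Fintype α] (P : PMF Ω) (f : Ω → α) : ℝ :=
  ∑ a, -((P.map f a).toReal * Real.logb 2 (P.map f a).toReal)

/-- Conditional entropy `H(f | g) = H(f, g) - H(g)`. -/
def condEntropy {Ω α β : Type*} [Fintype α] [Fintype β] (P : PMF Ω) (f : Ω → α) (g : Ω → β) : ℝ :=
  entropy P (fun ω => (f ω, g ω)) - entropy P g

/-- Mutual information `I(f ; g) = H(f) + H(g) - H(f, g)`. -/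
def mutualInfo {Ω α β : Type*} [Fintype α] [Fintype β] (P : PMF Ω) (f : Ω → α) (g : Ω → β) : ℝ :=
  entropy P f + entropy P g - entropy P (fun ω => (f ω, g ω))

/-! ### Combinatorial keys

Receivers `1, …, K` are the elements `0, …, K - 1` of `Fin K`. -/

/-- The non-empty sets of receivers. -/
abbrev KeySet (K : ℕ) : Type := {U : Finset (Fin K) // U.Nonempty}

/-- One block of all keys: for every non-empty `U`, the key `s_U` has `ℓ U` symbols of `F`. -/
abbrev Keys {K : ℕ} (F : Type) (ℓ : KeySet K → ℕ) : Type :=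
  (U : KeySet K) → Fin (ℓ U) → F

/-- The alphabet of `z_k`, the collection of those `s_U` with `k ∈ U`. -/
abbrev View {K : ℕ} (F : Type) (ℓ : KeySet K → ℕ) (k : Fin K) : Type :=
  (U : {U : KeySet K // k ∈ U.1}) → Fin (ℓ U.1) → F

/-- The key `z_k` as a function of all the keys `s_U`. -/
def view {K : ℕ} {F : Type} {ℓ : KeySet K → ℕ} (k : Fin K) (s : Keys F ℓ) : View F ℓ k :=
  fun U => s U.1

/-- All symbols of all keys in `L` blocks are independent and uniform. -/
def keyLaw {K : ℕ} (F : Type) [Field F] [Fintype F] (ℓ : KeySet K → ℕ) (L : ℕ) :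
    PMF (Fin L → Keys F ℓ) :=
  PMF.uniformOfFintype _

/-- `H(s_U)`, for one block. -/
def keyEntropy {K : ℕ} (F : Type) [Field F] [Fintype F] (ℓ : KeySet K → ℕ)
    (U : Finset (Fin K)) (hU : U.Nonempty := by decide) : ℝ :=
  entropy (PMF.uniformOfFintype (Keys F ℓ)) (fun s => s ⟨U, hU⟩)

/-- `H(z_q | z_e)`, for one block. -/
def viewCondEntropy {K : ℕ} (F : Type) [Field F] [Fintype F] (ℓ : KeySet K → ℕ)
    (q e : Fin K) : ℝ :=
  condEntropy (PMF.uniformOfFintype (Keys F ℓ)) (view q) (view e)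

/-! ### Schemes -/

/-- A groupcast scheme with key block length `L`: the message `W` has `lenW` symbols and the
transmit signal `X` has `lenX` symbols of a finite field `A`, and `enc w s` is the conditional law
of `X` given `W = w` and given the keys (the transmitter may randomize). -/
structure Scheme {K : ℕ} (F : Type) [Field F] [Fintype F] (ℓ : KeySet K → ℕ) (L : ℕ) where
  A : Type
  [fieldA : Field A]
  [fintypeA : Fintype A]
  lenW : ℕ
  lenX : ℕ
  enc : (Fin lenW → A) → (Fin L → Keys F ℓ) → PMF (Fin lenX → A)

attribute [instance] Scheme.fieldA Scheme.fintypeA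

namespace Scheme

variable {K : ℕ} {F : Type} [Field F] [Fintype F] {ℓ : KeySet K → ℕ} {L : ℕ}

abbrev Msg (σ : Scheme F ℓ L) : Type := Fin σ.lenW → σ.A

abbrev Sig (σ : Scheme F ℓ L) : Type := Fin σ.lenX → σ.A

/-- What Receiver `k` observes: the transmit signal and `L` blocks of `z_k`. -/
abbrev Obs (σ : Scheme F ℓ L) (k : Fin K) : Type := σ.Sig × (Fin L → View F ℓ k)

/-- The sample space of `(W, keys, X)`. -/
abbrev Space (σ : Scheme F ℓ L) : Type := σ.Msg × (Fin L → Keys F ℓ) × σ.Sig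

/-- Joint law of `(W, keys, X)`: `W` is uniform and independent of the keys. -/
def law (σ : Scheme F ℓ L) : PMF σ.Space :=
  (PMF.uniformOfFintype σ.Msg).bind fun w =>
    (keyLaw F ℓ L).bind fun s =>
      (σ.enc w s).map fun x => (w, s, x)

/-- The message `W`. -/
def msg (σ : Scheme F ℓ L) (ω : σ.Space) : σ.Msg := ω.1

/-- The pair `(X, Z_k)`. -/
def obs (σ : Scheme F ℓ L) (k : Fin K) (ω : σ.Space) : σ.Obs k :=
  (ω.2.2, fun l => view k (ω.2.1 l))

/-- `L_W log₂ p / L`, in bits per key block. -/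
def rate (σ : Scheme F ℓ L) : ℝ :=
  (σ.lenW : ℝ) * Real.logb 2 (Fintype.card σ.A) / L

/-- `L_X log₂ p / L`, in bits per key block. -/
def bandwidth (σ : Scheme F ℓ L) : ℝ :=
  (σ.lenX : ℝ) * Real.logb 2 (Fintype.card σ.A) / L

/-- `H(W | X, Z_k)`. -/
def equivocation (σ : Scheme F ℓ L) (k : Fin K) : ℝ :=
  condEntropy σ.law σ.msg (σ.obs k)

/-- `I(W ; X, Z_k)`. -/
def leakage (σ : Scheme F ℓ L) (k : Fin K) : ℝ :=
  mutualInfo σ.law σ.msg (σ.obs k)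

/-- Probability that the decoder `d` of Receiver `k` does not return the message. -/
def errorProb (σ : Scheme F ℓ L) (k : Fin K) (d : σ.Obs k → σ.Msg) : ℝ :=
  (σ.law.toOuterMeasure {ω | d (σ.obs k ω) ≠ σ.msg ω}).toReal

end Scheme

/-! ### Achievability -/

/-- The two forms of the correctness requirement: the decoding error probability tends to zero,
or `H(W | X, Z_k) = o(L)`. -/
inductive Reliability where
  | vanishingError
  | vanishingEquivocation

open Filter Asymptotics in
/-- Correctness at Receiver `k` of a sequence of schemes indexed by the block length `L`. -/
def Reliability.Holds {K : ℕ} {F : Type} [Field F] [Fintype F] {ℓ : KeySet K → ℕ}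
    (σ : (L : ℕ) → Scheme F ℓ L) (k : Fin K) : Reliability → Prop
  | vanishingError => ∃ d : (L : ℕ) → (σ L).Obs k → (σ L).Msg,
      Tendsto (fun L => (σ L).errorProb k (d L)) atTop (nhds 0)
  | vanishingEquivocation =>
      (fun L => (σ L).equivocation k) =o[atTop] (fun L : ℕ => (L : ℝ))

open Filter Asymptotics in
/-- A sequence of secure groupcast schemes to the first `N` of `K` receivers; the symbols of the
message and of the transmit signal are from fields with sizes in `Q`. -/
structure IsSecureGroupcast {K : ℕ} {F : Type} [Field F] [Fintype F] {ℓ : KeySet K → ℕ}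
    (N : ℕ) (Q : Set ℕ) (c : Reliability) (σ : (L : ℕ) → Scheme F ℓ L) : Prop where
  fieldSize : ∀ L, 0 < L → Fintype.card (σ L).A ∈ Q
  correct : ∀ k : Fin K, (k : ℕ) < N → c.Holds σ k
  secure : ∀ k : Fin K, N ≤ (k : ℕ) →
    (fun L => (σ L).leakage k) =o[atTop] (fun L : ℕ => (L : ℝ))

/-- The rate `R` is achievable. -/
def AchievableRate {K : ℕ} (N : ℕ) (F : Type) [Field F] [Fintype F] (ℓ : KeySet K → ℕ)
    (Q : Set ℕ) (c : Reliability) (R : ℝ) : Prop :=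
  ∃ σ : (L : ℕ) → Scheme F ℓ L, IsSecureGroupcast N Q c σ ∧
    ∀ L, 0 < L → R ≤ (σ L).rate

/-- The broadcast bandwidth `β` is achievable for the rate `R`. -/
def AchievableBandwidth {K : ℕ} (N : ℕ) (F : Type) [Field F] [Fintype F] (ℓ : KeySet K → ℕ)
    (Q : Set ℕ) (c : Reliability) (R β : ℝ) : Prop :=
  ∃ σ : (L : ℕ) → Scheme F ℓ L, IsSecureGroupcast N Q c σ ∧
    ∀ L, 0 < L → R ≤ (σ L).rate ∧ (σ L).bandwidth ≤ β

/-- `C` is the capacity: the supremum of the achievable rates. -/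
def IsCapacity {K : ℕ} (N : ℕ) (F : Type) [Field F] [Fintype F] (ℓ : KeySet K → ℕ)
    (Q : Set ℕ) (c : Reliability) (C : ℝ) : Prop :=
  IsLUB {R | AchievableRate N F ℓ Q c R} C

/-- `β` is the minimum broadcast bandwidth for the rate `R`: the infimum of the achievable
broadcast bandwidths. -/
def IsMinBandwidth {K : ℕ} (N : ℕ) (F : Type) [Field F] [Fintype F] (ℓ : KeySet K → ℕ)
    (Q : Set ℕ) (c : Reliability) (R β : ℝ) : Prop :=
  IsGLB {b | AchievableBandwidth N F ℓ Q c R b} β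

end

/-! Receivers `0`, `1` are qualified and `2`, `3` are eavesdroppers. The converse rests on two
entropy inequalities, both up to `o(L)`. Decodability at `q` and secrecy at `e` force H(W) ≤ H(Z_q |
Z_e) (`entropy_message_le`), which bounds the rate. Moreover, given W, X and Z_e, each Z_q has lost
at least H(W) of its entropy given Z_e, so the pair (Z_0, Z_1) has lost at least 2H(W) - I(Z_0; Z_1
| Z_e). Since W is independent of the keys, only X can account for this loss, and H(X) is at least
as large (`two_mul_entropy_message_le`). For combinatorial keys the conditional information counts
the keys held by both `0` and `1` but not by `e`: the key of {0, 1} and that of {0, 1, e'}, with e'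
the other eavesdropper.

Achievability is a one-time pad on single blocks. For Receiver `q` a message symbol is covered by
the key of {0, 1}, by the key of {q}, or by a sum of two symbols, one unknown to `2` and one unknown
to `3`. The sums draw on the keys of {0, 1, 2} and {0, 1, 3} before those of {q, 2} and {q, 3}, so
the first μ sums, with μ the smaller length of the two triple keys, are the same for both receivers
and the symbols they cover are sent once. Secrecy holds because a change of the keys invisible to
`e` turns the signal of any message into that of the message 0 (`groupcastEncode_secure`,
`blockScheme_leakage_eq_zero`). The rate and the bandwidth meet both bounds exactly. -/

/-! ### Entropy of finite-valued random variables -/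

/-- The probability that `f` takes the value `a`. -/
noncomputable def mass {Ω α : Type*} (P : PMF Ω) (f : Ω → α) (a : α) : ℝ := (P.map f a).toReal

section Entropy

variable {Ω α β γ : Type*} [Fintype α] [Fintype β] [Fintype γ] (P : PMF Ω)

theorem mass_nonneg {α : Type*} (f : Ω → α) (a : α) : 0 ≤ mass P f a := ENNReal.toReal_nonneg

theorem mass_comp {β : Type*} [DecidableEq β] (f : Ω → α) (φ : α → β) (b : β) :
    mass P (fun ω => φ (f ω)) b = ∑ a, if φ a = b then mass P f a else 0 := by
  have h : P.map (fun ω => φ (f ω)) = (P.map f).map φ := (PMF.map_comp f P φ).symm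
  unfold mass
  rw [h, PMF.map_apply, tsum_fintype, ENNReal.toReal_sum]
  · refine Finset.sum_congr rfl fun a _ => ?_
    by_cases hab : φ a = b
    · simp [hab]
    · simp [hab, Ne.symm hab]
  · intro a _
    split_ifs
    · exact PMF.apply_ne_top _ _
    · simp

theorem sum_mass (f : Ω → α) : ∑ a, mass P f a = 1 := by
  unfold mass
  rw [← ENNReal.toReal_sum fun a _ => PMF.apply_ne_top _ _,
    ← tsum_fintype (L := .unconditional α), PMF.tsum_coe]
  simp

theorem mass_le_mass_comp {β : Type*} (f : Ω → α) (φ : α → β) (a : α) :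
    mass P f a ≤ mass P (fun ω => φ (f ω)) (φ a) := by
  classical
  rw [mass_comp P f φ]
  refine le_trans ?_ (Finset.single_le_sum (f := fun a' => if φ a' = φ a then mass P f a' else 0)
    (fun a' _ => ?_) (Finset.mem_univ a))
  · simp
  · split_ifs
    · exact mass_nonneg _ _ _
    · exact le_rfl

theorem sum_mass_left (f : Ω → α) (g : Ω → β) (b : β) :
    ∑ a, mass P (fun ω => (f ω, g ω)) (a, b) = mass P g b := by
  classical
  have := mass_comp P (fun ω => (f ω, g ω)) Prod.snd b
  rw [Fintype.sum_prod_type] at this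
  simpa using this.symm

/-- Writing the entropies of several marginals as sums over one joint alphabet lets them be compared
term by term. -/
theorem entropy_comp (f : Ω → α) (φ : α → β) :
    entropy P (fun ω => φ (f ω)) =
      ∑ a, -(mass P f a * Real.logb 2 (mass P (fun ω => φ (f ω)) (φ a))) := by
  classical
  have h : ∀ b, -(mass P (fun ω => φ (f ω)) b * Real.logb 2 (mass P (fun ω => φ (f ω)) b)) =
      ∑ a, if φ a = b then
        -(mass P f a * Real.logb 2 (mass P (fun ω => φ (f ω)) (φ a))) else 0 := by
    intro b
    nth_rw 1 [mass_comp P f φ b]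
    rw [Finset.sum_mul, ← Finset.sum_neg_distrib]
    refine Finset.sum_congr rfl fun a _ => ?_
    split_ifs with hab
    · rw [hab]
    · simp
  calc entropy P (fun ω => φ (f ω))
      = ∑ b, -(mass P (fun ω => φ (f ω)) b * Real.logb 2 (mass P (fun ω => φ (f ω)) b)) := rfl
    _ = _ := by
      rw [Finset.sum_congr rfl fun b _ => h b, Finset.sum_comm]
      simp

/-- This is log x ≤ x - 1 at x = q/p. The weights need not be normalized, which spares the
applications from computing the total of q exactly. -/
theorem gibbs_inequality {ι : Type*} [Fintype ι] (p q : ι → ℝ) (hp : ∀ i, 0 ≤ p i)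
    (hq : ∀ i, 0 ≤ q i) (hpq : ∀ i, 0 < p i → 0 < q i) (hsum : ∑ i, q i ≤ ∑ i, p i) :
    ∑ i, -(p i * Real.logb 2 (p i)) ≤ ∑ i, -(p i * Real.logb 2 (q i)) := by
  have hlog : 0 < Real.log 2 := Real.log_pos one_lt_two
  have h : ∀ i, -(p i * Real.logb 2 (p i)) ≤
      -(p i * Real.logb 2 (q i)) + (q i - p i) / Real.log 2 := by
    intro i
    rcases (hp i).eq_or_lt with h0 | h0
    · rw [← h0]
      simpa using div_nonneg (hq i) hlog.le
    · have hqi := hpq i h0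
      have h1 := Real.log_le_sub_one_of_pos (div_pos hqi h0)
      rw [Real.log_div hqi.ne' h0.ne'] at h1
      have h2 : p i * (Real.log (q i) - Real.log (p i)) ≤ q i - p i := by
        calc _ ≤ p i * (q i / p i - 1) := mul_le_mul_of_nonneg_left h1 h0.le
          _ = q i - p i := by field_simp
      have h3 := div_le_div_of_nonneg_right h2 hlog.le
      have h4 : p i * (Real.log (q i) - Real.log (p i)) / Real.log 2 =
        p i * (Real.log (q i) / Real.log 2) - p i * (Real.log (p i) / Real.log 2) := by ring
      simp only [Real.logb]
      linarith
  have h1 := Finset.sum_le_sum fun i (_ : i ∈ Finset.univ) => h i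
  rw [Finset.sum_add_distrib, ← Finset.sum_div, Finset.sum_sub_distrib] at h1
  have h2 : (∑ i, q i - ∑ i, p i) / Real.log 2 ≤ 0 :=
    div_nonpos_of_nonpos_of_nonneg (by linarith) hlog.le
  linarith

theorem entropy_le_logb_card (f : Ω → α) : entropy P f ≤ Real.logb 2 (Fintype.card α) := by
  have hne : Nonempty α := ⟨f P.support_nonempty.some⟩
  have hc : (0 : ℝ) < Fintype.card α := by exact_mod_cast Fintype.card_pos
  have h := gibbs_inequality (mass P f) (fun _ => (Fintype.card α : ℝ)⁻¹) (mass_nonneg P f)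
    (fun _ => by positivity) (fun _ _ => by positivity)
    (by rw [sum_mass]; simp [hc.ne'])
  refine h.trans (le_of_eq ?_)
  rw [Finset.sum_neg_distrib, ← Finset.sum_mul, sum_mass]
  simp

/-- Gibbs' inequality for the joint law against p(a,c) p(b,c) / p(c), the law that makes `f` and `g`
independent given `h`. -/
theorem entropy_submodular (f : Ω → α) (g : Ω → β) (h : Ω → γ) :
    entropy P (fun ω => (f ω, g ω, h ω)) + entropy P h ≤
      entropy P (fun ω => (f ω, h ω)) + entropy P (fun ω => (g ω, h ω)) := by
  set J : Ω → α × β × γ := fun ω => (f ω, g ω, h ω) with hJ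
  have e1 := entropy_comp P J fun t => t.2.2
  have e2 := entropy_comp P J fun t => (t.1, t.2.2)
  have e3 := entropy_comp P J fun t => (t.2.1, t.2.2)
  have m1 := mass_le_mass_comp P J fun t => t.2.2
  have m2 := mass_le_mass_comp P J fun t => (t.1, t.2.2)
  have m3 := mass_le_mass_comp P J fun t => (t.2.1, t.2.2)
  simp only [hJ] at e1 e2 e3 m1 m2 m3
  rw [← hJ] at e1 e2 e3 m1 m2 m3
  have hg := gibbs_inequality (mass P J) (fun t => mass P (fun ω => (f ω, h ω)) (t.1, t.2.2) *
      mass P (fun ω => (g ω, h ω)) (t.2.1, t.2.2) / mass P h t.2.2) (mass_nonneg P J)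
    (fun t => div_nonneg (mul_nonneg (mass_nonneg _ _ _) (mass_nonneg _ _ _)) (mass_nonneg _ _ _))
    (fun t ht => div_pos (mul_pos (ht.trans_le (m2 t)) (ht.trans_le (m3 t))) (ht.trans_le (m1 t)))
    (by
      rw [sum_mass, Fintype.sum_prod_type]
      simp only [Fintype.sum_prod_type]
      rw [Finset.sum_comm]
      rw [Finset.sum_congr rfl fun b _ => Finset.sum_comm, Finset.sum_comm]
      rw [← sum_mass P h]
      refine Finset.sum_le_sum fun c _ => ?_
      simp only [← Finset.sum_div, ← Finset.sum_mul, ← Finset.mul_sum, sum_mass_left]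
      -- This also covers p(c) = 0, where the quotient is 0 by convention.
      exact (mul_self_div_self _).le)
  have hs : ∑ t, -(mass P J t * Real.logb 2 (mass P (fun ω => (f ω, h ω)) (t.1, t.2.2) *
      mass P (fun ω => (g ω, h ω)) (t.2.1, t.2.2) / mass P h t.2.2)) =
      entropy P (fun ω => (f ω, h ω)) + entropy P (fun ω => (g ω, h ω)) - entropy P h := by
    rw [e1, e2, e3, ← Finset.sum_add_distrib, ← Finset.sum_sub_distrib]
    refine Finset.sum_congr rfl fun t _ => ?_
    rcases (mass_nonneg P J t).eq_or_lt with h0 | h0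
    · rw [← h0]; simp
    · have h1 := (h0.trans_le (m1 t)).ne'
      have h2 := (h0.trans_le (m2 t)).ne'
      have h3 := (h0.trans_le (m3 t)).ne'
      rw [Real.logb_div (mul_ne_zero h2 h3) h1, Real.logb_mul h2 h3]
      ring
  have : entropy P J ≤ _ := hg.trans_eq hs
  linarith

theorem entropy_injective_comp (f : Ω → α) {φ : α → β} (hφ : Function.Injective φ) :
    entropy P (fun ω => φ (f ω)) = entropy P f := by
  classical
  rw [entropy_comp]
  refine Finset.sum_congr rfl fun a _ => ?_
  rw [mass_comp P f φ]
  simp [hφ.eq_iff, mass]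

theorem entropy_pair_of_determines (f : Ω → α) (g : Ω → β)
    (hfg : ∀ ω ω', f ω = f ω' → g ω = g ω') :
    entropy P (fun ω => (f ω, g ω)) = entropy P f := by
  have : Nonempty β := ⟨g P.support_nonempty.some⟩
  obtain ⟨φ, hφ⟩ := (Function.factorsThrough_iff g (f := f)).1 fun ω ω' h => hfg ω ω' h
  subst hφ
  exact entropy_injective_comp P f (φ := fun a => (a, φ a)) fun a b h => (Prod.mk.inj h).1

theorem entropy_snd_le_pair (f : Ω → α) (g : Ω → β) :
    entropy P g ≤ entropy P (fun ω => (f ω, g ω)) := by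
  have h := entropy_submodular P f f g
  have : entropy P (fun ω => (f ω, f ω, g ω)) = entropy P (fun ω => (f ω, g ω)) :=
    entropy_injective_comp P (fun ω => (f ω, g ω)) (φ := fun t => (t.1, t.1, t.2)) (by
      rintro ⟨a, b⟩ ⟨c, d⟩ h
      simpa using h)
  linarith

theorem entropy_le_of_determines (f : Ω → α) (g : Ω → β)
    (hfg : ∀ ω ω', f ω = f ω' → g ω = g ω') : entropy P g ≤ entropy P f :=
  (entropy_snd_le_pair P f g).trans_eq (entropy_pair_of_determines P f g hfg)

theorem entropy_congr (f : Ω → α) (g : Ω → β) (hfg : ∀ ω ω', f ω = f ω' ↔ g ω = g ω') :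
    entropy P f = entropy P g :=
  le_antisymm (entropy_le_of_determines P g f fun ω ω' => (hfg ω ω').2)
    (entropy_le_of_determines P f g fun ω ω' => (hfg ω ω').1)

theorem entropy_nonneg (f : Ω → α) : 0 ≤ entropy P f := by
  refine Finset.sum_nonneg fun a _ => ?_
  have h1 : mass P f a ≤ 1 := by
    rw [← sum_mass P f]
    exact Finset.single_le_sum (fun b _ => mass_nonneg P f b) (Finset.mem_univ a)
  have := mul_nonpos_of_nonneg_of_nonpos (mass_nonneg P f a)
    (Real.logb_nonpos one_lt_two (mass_nonneg P f a) h1)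
  unfold mass at this
  linarith

theorem entropy_pair_le_add (f : Ω → α) (g : Ω → β) :
    entropy P (fun ω => (f ω, g ω)) ≤ entropy P f + entropy P g := by
  have h := entropy_submodular P f g fun _ => ()
  have h1 : entropy P (fun ω => (f ω, g ω, ())) = entropy P (fun ω => (f ω, g ω)) :=
    entropy_congr P _ _ (by simp)
  have h2 : entropy P (fun ω => (f ω, ())) = entropy P f := entropy_congr P _ _ (by simp)
  have h3 : entropy P (fun ω => (g ω, ())) = entropy P g := entropy_congr P _ _ (by simp)
  have := entropy_nonneg P fun _ => ()
  linarith

theorem mutualInfo_nonneg (f : Ω → α) (g : Ω → β) : 0 ≤ mutualInfo P f g := by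
  have := entropy_pair_le_add P f g
  unfold mutualInfo
  linarith

theorem condEntropy_nonneg (f : Ω → α) (g : Ω → β) : 0 ≤ condEntropy P f g := by
  have := entropy_snd_le_pair P f g
  unfold condEntropy
  linarith

/-- Data processing. -/
theorem mutualInfo_le_of_determines (w : Ω → α) (f : Ω → β) (g : Ω → γ)
    (hfg : ∀ ω ω', f ω = f ω' → g ω = g ω') : mutualInfo P w g ≤ mutualInfo P w f := by
  have h := entropy_submodular P w f g
  have h1 : entropy P (fun ω => (w ω, f ω, g ω)) = entropy P (fun ω => (w ω, f ω)) :=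
    entropy_congr P _ _ fun ω ω' => by
      have := hfg ω ω'
      simp only [Prod.mk.injEq]
      tauto
  have h2 := entropy_pair_of_determines P f g hfg
  unfold mutualInfo
  linarith

/-- Two variables whose pair is uniform are each uniform. -/
theorem entropy_eq_of_pair (f : Ω → α) (g : Ω → β)
    (h : entropy P (fun ω => (f ω, g ω)) =
      Real.logb 2 (Fintype.card α) + Real.logb 2 (Fintype.card β)) :
    entropy P f = Real.logb 2 (Fintype.card α) ∧ entropy P g = Real.logb 2 (Fintype.card β) := by
  have h1 := entropy_pair_le_add P f g
  have h2 := entropy_le_logb_card P f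
  have h3 := entropy_le_logb_card P g
  constructor <;> linarith

theorem entropy_uniform [Nonempty α] :
    entropy (PMF.uniformOfFintype α) id = Real.logb 2 (Fintype.card α) := by
  have hc : (Fintype.card α : ℝ) ≠ 0 := by simp
  simp [entropy, PMF.map_id, hc]

theorem entropy_map {Ω' : Type*} (G : Ω → Ω') (f : Ω' → α) :
    entropy (P.map G) f = entropy P (fun ω => f (G ω)) := by
  unfold entropy
  rw [PMF.map_comp]
  rfl

theorem fano_inequality (w : Ω → α) (o : Ω → β) (d : β → α) :
    condEntropy P w o ≤
      1 + (P.toOuterMeasure {ω | d (o ω) ≠ w ω}).toReal * Real.logb 2 (Fintype.card α) := by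
  classical
  have hne : Nonempty α := ⟨w P.support_nonempty.some⟩
  have hc : (0 : ℝ) < Fintype.card α := by exact_mod_cast Fintype.card_pos
  set J : Ω → α × β := fun ω => (w ω, o ω) with hJ
  have e1 := entropy_comp P J Prod.snd
  have m1 := mass_le_mass_comp P J Prod.snd
  simp only [hJ] at e1 m1
  rw [← hJ] at e1 m1
  have hpe : (P.toOuterMeasure {ω | d (o ω) ≠ w ω}).toReal =
      ∑ t, if d t.2 = t.1 then 0 else mass P J t := by
    have : P.toOuterMeasure {ω | d (o ω) ≠ w ω} =
        (P.map J).toOuterMeasure {t | d t.2 ≠ t.1} := by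
      rw [PMF.toOuterMeasure_map_apply]
      rfl
    rw [this, PMF.toOuterMeasure_apply_fintype, ENNReal.toReal_sum]
    · refine Finset.sum_congr rfl fun t _ => ?_
      by_cases h : d t.2 = t.1 <;> simp [h, mass]
    · intro t _
      exact ne_top_of_le_ne_top (PMF.apply_ne_top (P.map J) t)
        (Set.indicator_le_self' (fun _ _ => zero_le) t)
  -- Comparison law for Gibbs: given the observation, weight 1/2 on the decoder's guess and 1/(2|α|)
  -- on every other message. The halves produce the summand 1 and the factor 1/|α| the term with log
  -- |α|.
  set q : α × β → ℝ := fun t => mass P o t.2 *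
    ((if d t.2 = t.1 then 1 else (Fintype.card α : ℝ)⁻¹) / 2) with hq
  have hr : ∀ t : α × β, 0 < (if d t.2 = t.1 then 1 else (Fintype.card α : ℝ)⁻¹) / 2 := by
    intro t
    split_ifs <;> positivity
  have hg := gibbs_inequality (mass P J) q (mass_nonneg P J)
    (fun t => mul_nonneg (mass_nonneg _ _ _) (hr t).le)
    (fun t ht => mul_pos (ht.trans_le (m1 t)) (hr t))
    (by
      rw [sum_mass, Fintype.sum_prod_type_right, ← sum_mass P o]
      refine Finset.sum_le_sum fun b _ => ?_
      simp only [hq, ← Finset.mul_sum, ← Finset.sum_div]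
      refine mul_le_of_le_one_right (mass_nonneg _ _ _) ?_
      have : ∑ a, (if d b = a then 1 else (Fintype.card α : ℝ)⁻¹) ≤
          ∑ a, ((if d b = a then 1 else 0) + (Fintype.card α : ℝ)⁻¹) := by
        refine Finset.sum_le_sum fun a _ => ?_
        split_ifs
        · have : (0 : ℝ) < (Fintype.card α : ℝ)⁻¹ := by positivity
          linarith
        · simp
      rw [Finset.sum_add_distrib] at this
      simp [hc.ne'] at this
      linarith)
  have hs : ∑ t, -(mass P J t * Real.logb 2 (q t)) = entropy P o + 1 +
      (P.toOuterMeasure {ω | d (o ω) ≠ w ω}).toReal * Real.logb 2 (Fintype.card α) := by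
    rw [e1, hpe, ← sum_mass P J, Finset.sum_mul, ← Finset.sum_add_distrib,
      ← Finset.sum_add_distrib]
    refine Finset.sum_congr rfl fun t _ => ?_
    rcases (mass_nonneg P J t).eq_or_lt with h0 | h0
    · rw [← h0]; simp
    · have h1 := (h0.trans_le (m1 t)).ne'
      simp only [hq]
      rw [Real.logb_mul h1 (hr t).ne']
      split_ifs with h
      · rw [Real.logb_div one_ne_zero two_ne_zero]
        simp
        ring
      · rw [Real.logb_div (inv_ne_zero hc.ne') two_ne_zero, Real.logb_inv]
        simp
        ring
  have : entropy P J ≤ _ := hg.trans_eq hs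
  unfold condEntropy
  linarith

end Entropy

/-! ### Entropy inequalities for the converse -/

section Converse

variable {Ω α β γ δ ε : Type*} [Fintype α] [Fintype β] [Fintype γ] [Fintype δ] [Fintype ε]
  (P : PMF Ω)

/-- A message that is decodable from `(X, Z₁)` and hidden by `(X, Z)` has at most the entropy of
`Z₁` given `Z`. -/
theorem entropy_message_le (W : Ω → α) (X : Ω → β) (Z₁ : Ω → γ) (Z : Ω → ε) :
    entropy P W ≤ condEntropy P W (fun ω => (X ω, Z₁ ω)) + mutualInfo P W (fun ω => (X ω, Z ω)) +
      condEntropy P Z₁ Z := by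
  -- The chain is H(W | X, Z) ≤ H(W, Z₁ | X, Z) ≤ H(Z₁ | Z) + H(W | X, Z₁).
  have a := entropy_snd_le_pair P Z₁ fun ω => (W ω, X ω, Z ω)
  have b := entropy_submodular P W Z fun ω => (X ω, Z₁ ω)
  have c := entropy_submodular P X Z₁ Z
  have e1 : entropy P (fun ω => (Z₁ ω, W ω, X ω, Z ω)) =
      entropy P (fun ω => (W ω, Z ω, X ω, Z₁ ω)) :=
    entropy_congr P _ _ fun _ _ => by simp only [Prod.mk.injEq]; tauto
  have e2 : entropy P (fun ω => (Z ω, X ω, Z₁ ω)) = entropy P (fun ω => (X ω, Z₁ ω, Z ω)) :=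
    entropy_congr P _ _ fun _ _ => by simp only [Prod.mk.injEq]; tauto
  unfold condEntropy mutualInfo
  linarith

/-- A message that is independent of the keys, decodable from `(X, Z₁)` and from `(X, Z₂)`, and
hidden by `(X, Z)`, is short in comparison with the signal `X`. -/
theorem two_mul_entropy_message_le (W : Ω → α) (X : Ω → β) (Z₁ : Ω → γ) (Z₂ : Ω → δ) (Z : Ω → ε)
    (hW : mutualInfo P W (fun ω => (Z₁ ω, Z₂ ω, Z ω)) ≤ 0) :
    2 * entropy P W ≤ entropy P X + condEntropy P W (fun ω => (X ω, Z₁ ω)) +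
      condEntropy P W (fun ω => (X ω, Z₂ ω)) + 2 * mutualInfo P W (fun ω => (X ω, Z ω)) +
      (condEntropy P Z₁ Z + condEntropy P Z₂ Z - condEntropy P (fun ω => (Z₁ ω, Z₂ ω)) Z) := by
  -- With i = 1, 2, these four give H(Z_i | W, X, Z) ≤ H(Z_i | Z) - H(W) + H(W | X, Z_i) + I(W; X,
  -- Z).
  have b1 := entropy_submodular P W Z fun ω => (X ω, Z₁ ω)
  have b2 := entropy_submodular P W Z fun ω => (X ω, Z₂ ω)
  have c1 := entropy_submodular P X Z₁ Z
  have c2 := entropy_submodular P X Z₂ Z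
  have e1 : entropy P (fun ω => (Z ω, X ω, Z₁ ω)) = entropy P (fun ω => (X ω, Z₁ ω, Z ω)) :=
    entropy_congr P _ _ fun _ _ => by simp only [Prod.mk.injEq]; tauto
  have e2 : entropy P (fun ω => (Z ω, X ω, Z₂ ω)) = entropy P (fun ω => (X ω, Z₂ ω, Z ω)) :=
    entropy_congr P _ _ fun _ _ => by simp only [Prod.mk.injEq]; tauto
  have d := entropy_submodular P Z₁ Z₂ fun ω => (W ω, X ω, Z ω)
  have d1 : entropy P (fun ω => (Z₁ ω, W ω, X ω, Z ω)) =
      entropy P (fun ω => (W ω, Z ω, X ω, Z₁ ω)) :=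
    entropy_congr P _ _ fun _ _ => by simp only [Prod.mk.injEq]; tauto
  have d2 : entropy P (fun ω => (Z₂ ω, W ω, X ω, Z ω)) =
      entropy P (fun ω => (W ω, Z ω, X ω, Z₂ ω)) :=
    entropy_congr P _ _ fun _ _ => by simp only [Prod.mk.injEq]; tauto
  -- Since W is independent of the keys, H(Z₁, Z₂ | Z) ≤ H(X) + H(Z₁, Z₂ | W, X, Z); by `d` the last
  -- term is at most the sum of the two terms bounded above.
  have m := entropy_snd_le_pair P X fun ω => (W ω, Z₁ ω, Z₂ ω, Z ω)
  have m1 : entropy P (fun ω => (X ω, W ω, Z₁ ω, Z₂ ω, Z ω)) =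
      entropy P (fun ω => (Z₁ ω, Z₂ ω, W ω, X ω, Z ω)) :=
    entropy_congr P _ _ fun _ _ => by simp only [Prod.mk.injEq]; tauto
  have f := entropy_pair_le_add P X fun ω => (W ω, Z ω)
  have f' := entropy_pair_le_add P W Z
  have f1 : entropy P (fun ω => (X ω, W ω, Z ω)) = entropy P (fun ω => (W ω, X ω, Z ω)) :=
    entropy_congr P _ _ fun _ _ => by simp only [Prod.mk.injEq]; tauto
  have g : entropy P (fun ω => ((Z₁ ω, Z₂ ω), Z ω)) = entropy P (fun ω => (Z₁ ω, Z₂ ω, Z ω)) :=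
    entropy_congr P _ _ fun _ _ => by simp only [Prod.mk.injEq]; tauto
  unfold condEntropy mutualInfo at *
  linarith

end Converse

/-! ### Entropies of collections of combinatorial keys -/

section KeyEntropy

variable {K : ℕ} {F : Type} {ℓ : KeySet K → ℕ}

/-- The number of symbols per block of the keys `s_U` with `T U`. -/
def keyLength (ℓ : KeySet K → ℕ) (T : KeySet K → Prop) [DecidablePred T] : ℕ :=
  ∑ U, if T U then ℓ U else 0

/-- The keys `s_U` with `T U`, in blocks indexed by `ι`. -/
def keysWith {ι : Type*} (T : KeySet K → Prop) (s : ι → Keys F ℓ) :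
    ι → (U : {U : KeySet K // T U}) → Fin (ℓ U.1) → F :=
  fun i U => s i U.1

theorem keysWith_eq_iff {ι : Type*} (T : KeySet K → Prop) (s s' : ι → Keys F ℓ) :
    keysWith T s = keysWith T s' ↔ ∀ U, T U → ∀ i, s i U = s' i U := by
  simp only [keysWith, funext_iff, Subtype.forall]
  tauto

/-- `Z_k`, in blocks indexed by `ι`. -/
def views {ι : Type*} (k : Fin K) (s : ι → Keys F ℓ) : ι → View F ℓ k := fun i => view k (s i)

theorem views_eq_iff {ι : Type*} (k : Fin K) (s s' : ι → Keys F ℓ) :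
    views k s = views k s' ↔ ∀ U : KeySet K, k ∈ U.1 → ∀ i, s i U = s' i U :=
  keysWith_eq_iff (fun U => k ∈ U.1) s s'

variable [Fintype F]

theorem card_keysWith {ι : Type*} [Fintype ι] [DecidableEq ι] (T : KeySet K → Prop)
    [DecidablePred T] :
    Real.logb 2 (Fintype.card (ι → (U : {U : KeySet K // T U}) → Fin (ℓ U.1) → F)) =
      Fintype.card ι * (keyLength ℓ T * Real.logb 2 (Fintype.card F)) := by
  have h : keyLength ℓ T = ∑ U : {U : KeySet K // T U}, ℓ U.1 := by
    rw [keyLength, ← Finset.sum_filter]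
    exact Finset.sum_subtype _ (by simp) _
  rw [h]
  simp only [Fintype.card_fun, Fintype.card_pi, Fintype.card_fin, Finset.prod_pow_eq_pow_sum]
  rw [Nat.cast_pow, Nat.cast_pow, Real.logb_pow, Real.logb_pow]

theorem card_keys {ι : Type*} [Fintype ι] [DecidableEq ι] :
    Real.logb 2 (Fintype.card (ι → Keys F ℓ)) =
      Fintype.card ι * ((∑ U, ℓ U : ℕ) * Real.logb 2 (Fintype.card F)) := by
  simp only [Fintype.card_fun, Fintype.card_pi, Fintype.card_fin, Finset.prod_pow_eq_pow_sum]
  rw [Nat.cast_pow, Nat.cast_pow, Real.logb_pow, Real.logb_pow]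

variable {Ω ι : Type*} [Fintype ι] [DecidableEq ι] {P : PMF Ω} {S : Ω → ι → Keys F ℓ}

/-- The selected keys and the remaining ones together are all keys, which are uniform, so each of
the two parts is uniform. -/
theorem entropy_keysWith (hS : entropy P S = Real.logb 2 (Fintype.card (ι → Keys F ℓ)))
    (T : KeySet K → Prop) [DecidablePred T] :
    entropy P (fun ω => keysWith T (S ω)) =
      Fintype.card ι * (keyLength ℓ T * Real.logb 2 (Fintype.card F)) := by
  rw [← card_keysWith T]
  refine (entropy_eq_of_pair P (fun ω => keysWith T (S ω))
    (fun ω => keysWith (fun U => ¬ T U) (S ω)) ?_).1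
  have h : entropy P (fun ω => (keysWith T (S ω), keysWith (fun U => ¬ T U) (S ω))) =
      entropy P S := by
    refine entropy_congr P _ _ fun ω ω' => ?_
    rw [Prod.mk.injEq, keysWith_eq_iff, keysWith_eq_iff]
    refine ⟨fun h => ?_, fun h => by simp [h]⟩
    funext i U
    by_cases hU : T U
    · exact h.1 U hU i
    · exact h.2 U hU i
  have hsum : keyLength ℓ T + keyLength ℓ (fun U => ¬ T U) = ∑ U, ℓ U := by
    rw [keyLength, keyLength, ← Finset.sum_add_distrib]
    refine Finset.sum_congr rfl fun U _ => ?_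
    by_cases hU : T U <;> simp [hU]
  rw [h, hS, card_keysWith, card_keysWith, card_keys, ← hsum]
  push_cast
  ring

theorem condEntropy_views (hS : entropy P S = Real.logb 2 (Fintype.card (ι → Keys F ℓ)))
    (q e : Fin K) :
    condEntropy P (fun ω => views q (S ω)) (fun ω => views e (S ω)) = Fintype.card ι *
      (keyLength ℓ (fun U => q ∈ U.1 ∧ e ∉ U.1) * Real.logb 2 (Fintype.card F)) := by
  have h1 : entropy P (fun ω => (views q (S ω), views e (S ω))) =
      entropy P (fun ω => keysWith (fun U => q ∈ U.1 ∨ e ∈ U.1) (S ω)) :=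
    entropy_congr P _ _ fun ω ω' => by
      rw [Prod.mk.injEq, views_eq_iff, views_eq_iff, keysWith_eq_iff]
      simp only [or_imp, forall_and]
  have h2 : entropy P (fun ω => views e (S ω)) =
      entropy P (fun ω => keysWith (fun U => e ∈ U.1) (S ω)) := rfl
  have hsum : keyLength ℓ (fun U => q ∈ U.1 ∨ e ∈ U.1) =
      keyLength ℓ (fun U => q ∈ U.1 ∧ e ∉ U.1) + keyLength ℓ (fun U => e ∈ U.1) := by
    rw [keyLength, keyLength, keyLength, ← Finset.sum_add_distrib]
    refine Finset.sum_congr rfl fun U _ => ?_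
    by_cases h : e ∈ U.1 <;> by_cases h' : q ∈ U.1 <;> simp [h, h']
  rw [condEntropy, h1, h2, entropy_keysWith hS, entropy_keysWith hS, hsum]
  push_cast
  ring

set_option synthInstance.maxSize 1000 in
-- The left side is I(Z_q; Z_q' | Z_e), the correction term in `two_mul_entropy_message_le`.
theorem condEntropy_views_pair (hS : entropy P S = Real.logb 2 (Fintype.card (ι → Keys F ℓ)))
    (q q' e : Fin K) :
    condEntropy P (fun ω => views q (S ω)) (fun ω => views e (S ω)) +
      condEntropy P (fun ω => views q' (S ω)) (fun ω => views e (S ω)) -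
      condEntropy P (fun ω => (views q (S ω), views q' (S ω))) (fun ω => views e (S ω)) =
    Fintype.card ι * (keyLength ℓ (fun U => q ∈ U.1 ∧ q' ∈ U.1 ∧ e ∉ U.1) *
      Real.logb 2 (Fintype.card F)) := by
  have h1 : entropy P (fun ω => ((views q (S ω), views q' (S ω)), views e (S ω))) =
      entropy P (fun ω => keysWith (fun U => (q ∈ U.1 ∨ q' ∈ U.1) ∨ e ∈ U.1) (S ω)) :=
    entropy_congr P _ _ fun ω ω' => by
      rw [Prod.mk.injEq, Prod.mk.injEq, views_eq_iff, views_eq_iff, views_eq_iff, keysWith_eq_iff]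
      simp only [or_imp, forall_and]
  have h2 : entropy P (fun ω => views e (S ω)) =
      entropy P (fun ω => keysWith (fun U => e ∈ U.1) (S ω)) := rfl
  have hsum : keyLength ℓ (fun U => (q ∈ U.1 ∨ q' ∈ U.1) ∨ e ∈ U.1) +
      keyLength ℓ (fun U => q ∈ U.1 ∧ q' ∈ U.1 ∧ e ∉ U.1) =
      keyLength ℓ (fun U => q ∈ U.1 ∧ e ∉ U.1) + keyLength ℓ (fun U => q' ∈ U.1 ∧ e ∉ U.1) +
        keyLength ℓ (fun U => e ∈ U.1) := by
    simp only [keyLength, ← Finset.sum_add_distrib]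
    refine Finset.sum_congr rfl fun U _ => ?_
    by_cases h : e ∈ U.1 <;> by_cases h' : q ∈ U.1 <;> by_cases h'' : q' ∈ U.1 <;>
      simp [h, h', h'']
  rw [condEntropy_views hS, condEntropy_views hS, condEntropy, h1, h2, entropy_keysWith hS,
    entropy_keysWith hS]
  have hsum' := congrArg (Nat.cast : ℕ → ℝ) hsum
  push_cast at hsum'
  linear_combination -(Fintype.card ι * Real.logb 2 (Fintype.card F)) * hsum'

end KeyEntropy

section OneBlock

variable {K : ℕ} (F : Type) [Field F] [Fintype F] (ℓ : KeySet K → ℕ)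

/-- Blocks indexed by `Unit` make the multi-block formulas available for a single block. -/
theorem entropy_oneBlock :
    entropy (PMF.uniformOfFintype (Keys F ℓ)) (fun s (_ : Unit) => s) =
      Real.logb 2 (Fintype.card (Unit → Keys F ℓ)) := by
  have h := entropy_congr (PMF.uniformOfFintype (Keys F ℓ)) (fun s (_ : Unit) => s) id
    (fun s s' => by simp [funext_iff])
  rw [h, entropy_uniform]
  simp

theorem keyEntropy_eq (U : Finset (Fin K)) (hU : U.Nonempty) :
    keyEntropy F ℓ U hU = ℓ ⟨U, hU⟩ * Real.logb 2 (Fintype.card F) := by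
  have h := entropy_keysWith (entropy_oneBlock F ℓ) (fun V => V.1 = U)
  have h1 : keyEntropy F ℓ U hU = entropy (PMF.uniformOfFintype (Keys F ℓ))
      (fun s => keysWith (fun V => V.1 = U) (fun _ : Unit => s)) :=
    entropy_congr _ _ _ fun s s' => by
      rw [keysWith_eq_iff]
      refine ⟨fun h V hV i => ?_, fun h => h ⟨U, hU⟩ rfl ()⟩
      obtain ⟨V, _⟩ := V
      subst hV
      exact h
  have h2 : keyLength ℓ (fun V => V.1 = U) = ℓ ⟨U, hU⟩ := by
    rw [keyLength, Finset.sum_eq_single ⟨U, hU⟩]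
    · simp
    · intro V _ hV
      simpa using fun h => absurd (Subtype.ext h) hV
    · simp
  rw [h1, h, h2]
  simp

theorem viewCondEntropy_eq (q e : Fin K) :
    viewCondEntropy F ℓ q e =
      keyLength ℓ (fun U => q ∈ U.1 ∧ e ∉ U.1) * Real.logb 2 (Fintype.card F) := by
  have h := condEntropy_views (entropy_oneBlock F ℓ) q e
  simp only [Fintype.card_unit, Nat.cast_one, one_mul] at h
  rw [← h, viewCondEntropy, condEntropy, condEntropy]
  congr 1
  · exact entropy_congr _ _ _ fun s s' => by
      simp [views, funext_iff]
  · exact entropy_congr _ _ _ fun s s' => by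
      simp [views, funext_iff]

end OneBlock

/-! ### Joint law of message, keys and signal; bounds for a single scheme -/

theorem uniformOfFintype_prod {α β : Type*} [Fintype α] [Fintype β] [Nonempty α] [Nonempty β] :
    ((PMF.uniformOfFintype α).bind fun a => (PMF.uniformOfFintype β).map (Prod.mk a)) =
      PMF.uniformOfFintype (α × β) := by
  classical
  ext ⟨a, b⟩
  rw [PMF.bind_apply, tsum_fintype, Finset.sum_eq_single a]
  · rw [PMF.map_apply, tsum_fintype, Finset.sum_eq_single b]
    · simp only [PMF.uniformOfFintype_apply, Fintype.card_prod, Nat.cast_mul, if_true]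
      rw [ENNReal.mul_inv (by simp) (by simp)]
    · intro b' _ hb
      simp [Ne.symm hb]
    · simp
  · intro a' _ ha
    rw [PMF.map_apply, tsum_fintype]
    simp [Ne.symm ha]
  · simp

namespace Scheme

variable {K : ℕ} {F : Type} [Field F] [Fintype F] {ℓ : KeySet K → ℕ} {L : ℕ} (σ : Scheme F ℓ L)

theorem law_map_msg_keys :
    σ.law.map (fun ω => (ω.1, ω.2.1)) =
      PMF.uniformOfFintype (σ.Msg × (Fin L → Keys F ℓ)) := by
  rw [← uniformOfFintype_prod]
  simp only [law, keyLaw, PMF.map_bind, PMF.map_comp]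
  congr 1
  funext w
  rw [← PMF.bind_pure_comp]
  congr 1
  funext s
  exact PMF.map_const (σ.enc w s) (w, s)

theorem entropy_msg_keys :
    entropy σ.law (fun ω => (ω.1, ω.2.1)) =
      Real.logb 2 (Fintype.card σ.Msg) + Real.logb 2 (Fintype.card (Fin L → Keys F ℓ)) := by
  have h := entropy_map σ.law (fun ω => (ω.1, ω.2.1)) id
  rw [law_map_msg_keys, entropy_uniform, Fintype.card_prod, Nat.cast_mul,
    Real.logb_mul (Nat.cast_ne_zero.2 Fintype.card_ne_zero)
      (Nat.cast_ne_zero.2 Fintype.card_ne_zero)] at h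
  exact h.symm

theorem entropy_keys :
    entropy σ.law (fun ω => ω.2.1) = Real.logb 2 (Fintype.card (Fin L → Keys F ℓ)) :=
  (entropy_eq_of_pair σ.law (fun ω => ω.1) (fun ω => ω.2.1) σ.entropy_msg_keys).2

theorem logb_card_msg (hL : 0 < L) : Real.logb 2 (Fintype.card σ.Msg) = L * σ.rate := by
  have : (L : ℝ) ≠ 0 := by exact_mod_cast hL.ne'
  rw [rate, Fintype.card_fun, Fintype.card_fin, Nat.cast_pow, Real.logb_pow]
  field_simp

theorem entropy_msg (hL : 0 < L) : entropy σ.law σ.msg = L * σ.rate := by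
  rw [← logb_card_msg σ hL]
  exact (entropy_eq_of_pair σ.law (fun ω => ω.1) (fun ω => ω.2.1) σ.entropy_msg_keys).1

theorem entropy_signal_le (hL : 0 < L) :
    entropy σ.law (fun ω => ω.2.2) ≤ L * σ.bandwidth := by
  refine (entropy_le_logb_card _ _).trans_eq ?_
  have : (L : ℝ) ≠ 0 := by exact_mod_cast hL.ne'
  rw [bandwidth, Fintype.card_fun, Fintype.card_fin, Nat.cast_pow, Real.logb_pow]
  field_simp

theorem mutualInfo_msg_keys_nonpos : mutualInfo σ.law σ.msg (fun ω => ω.2.1) ≤ 0 := by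
  have h1 : entropy σ.law (fun ω => (σ.msg ω, ω.2.1)) = _ := σ.entropy_msg_keys
  have h2 := entropy_le_logb_card σ.law σ.msg
  have h3 := σ.entropy_keys
  unfold mutualInfo
  linarith

theorem rate_le (hL : 0 < L) (q e : Fin K) :
    L * σ.rate ≤ σ.equivocation q + σ.leakage e + L * viewCondEntropy F ℓ q e := by
  have h := entropy_message_le σ.law σ.msg (fun ω => ω.2.2) (fun ω => views q ω.2.1)
    (fun ω => views e ω.2.1)
  rw [condEntropy_views σ.entropy_keys, Fintype.card_fin, ← viewCondEntropy_eq,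
    σ.entropy_msg hL] at h
  exact h

set_option synthInstance.maxSize 1000 in
theorem two_mul_rate_le (hL : 0 < L) (q q' e : Fin K) :
    2 * (L * σ.rate) ≤ L * σ.bandwidth + σ.equivocation q + σ.equivocation q' +
      2 * σ.leakage e + L * (keyLength ℓ (fun U => q ∈ U.1 ∧ q' ∈ U.1 ∧ e ∉ U.1) *
        Real.logb 2 (Fintype.card F)) := by
  have hI : mutualInfo σ.law σ.msg
      (fun ω => (views q ω.2.1, views q' ω.2.1, views e ω.2.1)) ≤ 0 :=
    (mutualInfo_le_of_determines σ.law σ.msg (fun ω => ω.2.1) _ fun ω ω' h => by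
      simp only [h]).trans σ.mutualInfo_msg_keys_nonpos
  have h := two_mul_entropy_message_le σ.law σ.msg (fun ω => ω.2.2) (fun ω => views q ω.2.1)
    (fun ω => views q' ω.2.1) (fun ω => views e ω.2.1) hI
  rw [condEntropy_views_pair σ.entropy_keys, Fintype.card_fin, σ.entropy_msg hL] at h
  have hX := σ.entropy_signal_le hL
  have e1 : condEntropy σ.law σ.msg (fun ω => (ω.2.2, views q ω.2.1)) = σ.equivocation q := rfl
  have e2 : condEntropy σ.law σ.msg (fun ω => (ω.2.2, views q' ω.2.1)) = σ.equivocation q' := rfl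
  have e3 : mutualInfo σ.law σ.msg (fun ω => (ω.2.2, views e ω.2.1)) = σ.leakage e := rfl
  linarith

theorem equivocation_nonneg (k : Fin K) : 0 ≤ σ.equivocation k := condEntropy_nonneg _ _ _

theorem leakage_nonneg (k : Fin K) : 0 ≤ σ.leakage k := mutualInfo_nonneg _ _ _

theorem equivocation_le (hL : 0 < L) (k : Fin K) (d : σ.Obs k → σ.Msg) :
    σ.equivocation k ≤ 1 + σ.errorProb k d * (L * σ.rate) := by
  rw [← σ.logb_card_msg hL]
  exact fano_inequality σ.law σ.msg (σ.obs k) d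

theorem rate_nonneg : 0 ≤ σ.rate :=
  div_nonneg (mul_nonneg (Nat.cast_nonneg _) (Real.logb_nonneg one_lt_two (by
    exact_mod_cast Fintype.card_pos))) (Nat.cast_nonneg _)

end Scheme

/-! ### Passage to the limit in the converse -/

section Asymptotics

open Filter Asymptotics

theorem isLittleO_natCast_iff {f : ℕ → ℝ} (hf : ∀ L, 0 ≤ f L) :
    (f =o[atTop] fun L : ℕ => (L : ℝ)) ↔ ∀ ε > 0, ∀ᶠ L : ℕ in atTop, f L ≤ ε * L := by
  rw [isLittleO_iff]
  refine forall_congr' fun ε => ⟨fun h hε => ?_, fun h hε => ?_⟩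
  · filter_upwards [h hε] with L hL
    simpa [abs_of_nonneg (hf L)] using hL
  · filter_upwards [h hε] with L hL
    simpa [abs_of_nonneg (hf L)] using hL

theorem eventually_le_mul_natCast (b : ℝ) {ε : ℝ} (hε : 0 < ε) :
    ∀ᶠ L : ℕ in atTop, b ≤ ε * L := by
  filter_upwards [eventually_ge_atTop ⌈b / ε⌉₊] with L hL
  have := Nat.ceil_le.1 hL
  rwa [div_le_iff₀' hε] at this

variable {K N : ℕ} {F : Type} [Field F] [Fintype F] {ℓ : KeySet K → ℕ} {Q : Set ℕ}
  {c : Reliability} {σ : (L : ℕ) → Scheme F ℓ L}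

/-- Fano's bound contains the rate, which is not bounded a priori. The eavesdropper `e` supplies the
bound, through `Scheme.rate_le`. -/
theorem IsSecureGroupcast.equivocation_isLittleO (h : IsSecureGroupcast N Q c σ) (q e : Fin K)
    (hq : (q : ℕ) < N) (he : N ≤ (e : ℕ)) :
    (fun L => (σ L).equivocation q) =o[atTop] (fun L : ℕ => (L : ℝ)) := by
  have hc := h.correct q hq
  have hs := h.secure e he
  cases c with
  | vanishingEquivocation => exact hc
  | vanishingError =>
    obtain ⟨d, hd⟩ := hc
    rw [isLittleO_natCast_iff fun L => (σ L).leakage_nonneg e] at hs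
    rw [isLittleO_natCast_iff fun L => (σ L).equivocation_nonneg q]
    intro ε hε
    set B : ℝ := viewCondEntropy F ℓ q e
    have hB : 0 ≤ B := condEntropy_nonneg _ _ _
    -- Error probability at most 1/2 lets Fano's term be absorbed, giving L · rate ≤ 2(2 + B)L; the
    -- second bound then makes that term at most (ε/2)L.
    have hδ : 0 < min (1 / 2) (ε / (4 * (2 + B))) := by positivity
    filter_upwards [hd.eventually_le_const hδ, hs 1 one_pos, eventually_le_mul_natCast 1 one_pos,
      eventually_le_mul_natCast 1 (half_pos hε), eventually_gt_atTop 0] with L h1 h2 h3 h4 h5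
    have hrate := (σ L).rate_le h5 q e
    have hfano := (σ L).equivocation_le h5 q (d L)
    have hL : (0 : ℝ) ≤ L := Nat.cast_nonneg L
    have hr : 0 ≤ L * (σ L).rate := mul_nonneg hL (σ L).rate_nonneg
    have h6 := mul_le_mul_of_nonneg_right (h1.trans (min_le_left _ _)) hr
    have h7 := mul_le_mul_of_nonneg_right (h1.trans (min_le_right _ _)) hr
    have h8 : L * (σ L).rate ≤ 2 * (2 + B) * L := by linarith
    have h9 : ε / (4 * (2 + B)) * (L * (σ L).rate) ≤ ε / (4 * (2 + B)) * (2 * (2 + B) * L) :=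
      mul_le_mul_of_nonneg_left h8 (by positivity)
    have h10 : ε / (4 * (2 + B)) * (2 * (2 + B) * L) = ε / 2 * L := by
      field_simp
      ring
    linarith

theorem AchievableRate.le_viewCondEntropy {R : ℝ} (h : AchievableRate N F ℓ Q c R) (q e : Fin K)
    (hq : (q : ℕ) < N) (he : N ≤ (e : ℕ)) : R ≤ viewCondEntropy F ℓ q e := by
  obtain ⟨σ, hσ, hR⟩ := h
  refine le_of_forall_pos_le_add fun ε hε => ?_
  have h1 := hσ.equivocation_isLittleO q e hq he
  have h2 := hσ.secure e he
  rw [isLittleO_natCast_iff fun L => (σ L).equivocation_nonneg q] at h1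
  rw [isLittleO_natCast_iff fun L => (σ L).leakage_nonneg e] at h2
  obtain ⟨L, h1, h2, h3⟩ :=
    ((h1 _ (half_pos hε)).and ((h2 _ (half_pos hε)).and (eventually_gt_atTop 0))).exists
  have h4 := (σ L).rate_le h3 q e
  have hL : (0 : ℝ) < L := by exact_mod_cast h3
  have h5 := mul_le_mul_of_nonneg_left (hR L h3) hL.le
  refine le_of_mul_le_mul_left ?_ hL
  linarith

theorem AchievableBandwidth.two_mul_le {R β : ℝ} (h : AchievableBandwidth N F ℓ Q c R β)
    (q q' e : Fin K) (hq : (q : ℕ) < N) (hq' : (q' : ℕ) < N) (he : N ≤ (e : ℕ)) :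
    2 * R ≤ β + keyLength ℓ (fun U => q ∈ U.1 ∧ q' ∈ U.1 ∧ e ∉ U.1) *
      Real.logb 2 (Fintype.card F) := by
  obtain ⟨σ, hσ, hR⟩ := h
  refine le_of_forall_pos_le_add fun ε hε => ?_
  have h1 := hσ.equivocation_isLittleO q e hq he
  have h1' := hσ.equivocation_isLittleO q' e hq' he
  have h2 := hσ.secure e he
  rw [isLittleO_natCast_iff fun L => (σ L).equivocation_nonneg q] at h1
  rw [isLittleO_natCast_iff fun L => (σ L).equivocation_nonneg q'] at h1'
  rw [isLittleO_natCast_iff fun L => (σ L).leakage_nonneg e] at h2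
  have hε4 : 0 < ε / 4 := by positivity
  obtain ⟨L, h1, h1', h2, h3⟩ :=
    ((h1 _ hε4).and ((h1' _ hε4).and ((h2 _ hε4).and (eventually_gt_atTop 0)))).exists
  have h4 := (σ L).two_mul_rate_le h3 q q' e
  have hL : (0 : ℝ) < L := by exact_mod_cast h3
  have h5 := mul_le_mul_of_nonneg_left (hR L h3).1 hL.le
  have h6 := mul_le_mul_of_nonneg_left (hR L h3).2 hL.le
  refine le_of_mul_le_mul_left ?_ hL
  linarith

end Asymptotics

/-! ### Deterministic blockwise schemes -/

section BlockScheme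

open Filter Asymptotics

variable {K N : ℕ} {F : Type} {ℓ : KeySet K → ℕ} {n m : ℕ}

theorem mutualInfo_map {Ω Ω' α β : Type*} [Fintype α] [Fintype β] (P : PMF Ω) (G : Ω → Ω')
    (f : Ω' → α) (g : Ω' → β) :
    mutualInfo (P.map G) f g = mutualInfo P (fun ω => f (G ω)) (fun ω => g (G ω)) := by
  simp only [mutualInfo, entropy_map]

/-- The message symbols of block `l`. -/
def messageBlock {L : ℕ} (w : Fin (L * n) → F) (l : Fin L) : Fin n → F :=
  fun j => w (finProdFinEquiv (l, j))

/-- Blockwise application of an encoder for one block. -/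
def blockEncode (f : (Fin n → F) → Keys F ℓ → Fin m → F) {L : ℕ} (w : Fin (L * n) → F)
    (s : Fin L → Keys F ℓ) : Fin (L * m) → F :=
  fun t => f (messageBlock w (finProdFinEquiv.symm t).1) (s (finProdFinEquiv.symm t).1)
    (finProdFinEquiv.symm t).2

theorem blockEncode_block (f : (Fin n → F) → Keys F ℓ → Fin m → F) {L : ℕ}
    (w : Fin (L * n) → F) (s : Fin L → Keys F ℓ) (l : Fin L) :
    (fun i => blockEncode f w s (finProdFinEquiv (l, i))) = f (messageBlock w l) (s l) := by
  funext i
  simp [blockEncode]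

variable [Field F] [Fintype F]

/-- The scheme that applies a deterministic encoder for one block to each block. -/
noncomputable abbrev blockScheme (f : (Fin n → F) → Keys F ℓ → Fin m → F) (L : ℕ) :
    Scheme F ℓ L where
  A := F
  lenW := L * n
  lenX := L * m
  enc := fun w s => PMF.pure (blockEncode f w s)

variable (f : (Fin n → F) → Keys F ℓ → Fin m → F) {L : ℕ}

theorem blockScheme_rate (hL : 0 < L) :
    (blockScheme f L).rate = n * Real.logb 2 (Fintype.card F) := by
  have : (L : ℝ) ≠ 0 := by exact_mod_cast hL.ne'
  simp only [Scheme.rate, blockScheme, Nat.cast_mul]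
  field_simp

theorem blockScheme_bandwidth (hL : 0 < L) :
    (blockScheme f L).bandwidth = m * Real.logb 2 (Fintype.card F) := by
  have : (L : ℝ) ≠ 0 := by exact_mod_cast hL.ne'
  simp only [Scheme.bandwidth, blockScheme, Nat.cast_mul]
  field_simp

theorem blockScheme_law :
    (blockScheme f L).law =
      (PMF.uniformOfFintype ((Fin (L * n) → F) × (Fin L → Keys F ℓ))).map
        fun ws => (ws.1, ws.2, blockEncode f ws.1 ws.2) := by
  rw [← uniformOfFintype_prod]
  simp only [Scheme.law, keyLaw, blockScheme, PMF.map_bind, PMF.map_comp, PMF.pure_map]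
  rfl

theorem blockScheme_exists_errorProb_eq_zero (k : Fin K)
    (hk : ∀ w w' s s', f w s = f w' s' → view k s = view k s' → w = w') :
    ∃ d, (blockScheme f L).errorProb k d = 0 := by
  let o : (Fin (L * n) → F) × (Fin L → Keys F ℓ) → (blockScheme f L).Obs k :=
    fun ws => (blockEncode f ws.1 ws.2, views k ws.2)
  have ho : Function.FactorsThrough (fun ws => ws.1) o := by
    rintro ⟨w, s⟩ ⟨w', s'⟩ h
    obtain ⟨h1, h2⟩ := Prod.mk.inj h
    funext t
    have h3 := hk (messageBlock w (finProdFinEquiv.symm t).1)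
      (messageBlock w' (finProdFinEquiv.symm t).1) (s (finProdFinEquiv.symm t).1)
      (s' (finProdFinEquiv.symm t).1)
      (by
        rw [← blockEncode_block f, ← blockEncode_block f]
        exact congrArg (fun x i => x (finProdFinEquiv ((finProdFinEquiv.symm t).1, i))) h1)
      (congrFun h2 _)
    have h4 := congrFun h3 (finProdFinEquiv.symm t).2
    simpa only [messageBlock, Prod.mk.eta, Equiv.apply_symm_apply] using h4
  obtain ⟨d, hd⟩ := (Function.factorsThrough_iff _).1 ho
  refine ⟨d, ?_⟩
  have hempty : (fun ws : (Fin (L * n) → F) × (Fin L → Keys F ℓ) =>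
      ((ws.1, ws.2, blockEncode f ws.1 ws.2) : (blockScheme f L).Space)) ⁻¹'
      {ω | d ((blockScheme f L).obs k ω) ≠ (blockScheme f L).msg ω} = ∅ := by
    ext ws
    simp only [Set.mem_preimage, Set.mem_ofPred_eq, Set.mem_empty_iff_false, iff_false, not_not]
    exact (congrFun hd ws).symm
  unfold Scheme.errorProb
  rw [blockScheme_law, PMF.toOuterMeasure_map_apply, hempty]
  simp

/-- What `e` observes is a function of the shifted keys alone. These are independent of the message,
because (w, s) ↦ (w, s + shift w) is injective and so preserves the uniform law. -/
theorem blockScheme_leakage_eq_zero (e : Fin K)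
    (he : ∃ shift : (Fin n → F) → Keys F ℓ, ∀ w s,
      f w s = f 0 (s + shift w) ∧ view e (s + shift w) = view e s) :
    (blockScheme f L).leakage e = 0 := by
  obtain ⟨shift, hs⟩ := he
  refine le_antisymm ?_ ((blockScheme f L).leakage_nonneg e)
  rw [Scheme.leakage, blockScheme_law]
  refine (mutualInfo_map _ _ _ _).trans_le ?_
  let T : (Fin (L * n) → F) × (Fin L → Keys F ℓ) → Fin L → Keys F ℓ :=
    fun ws l => ws.2 l + shift (messageBlock ws.1 l)
  refine (mutualInfo_le_of_determines _ _ T _ fun ws ws' h => ?_).trans ?_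
  · have hT : ∀ l, ws.2 l + shift (messageBlock ws.1 l) =
        ws'.2 l + shift (messageBlock ws'.1 l) := congrFun h
    refine Prod.ext ?_ ?_
    · funext t
      simp only [Scheme.obs, blockEncode]
      rw [(hs _ _).1, hT, ← (hs _ _).1]
    · funext l
      simp only [Scheme.obs]
      rw [← (hs (messageBlock ws.1 l) (ws.2 l)).2, hT, (hs _ _).2]
  · set P := PMF.uniformOfFintype ((Fin (L * n) → F) × (Fin L → Keys F ℓ))
    have h1 : entropy P (fun ws => (ws.1, T ws)) =
        Real.logb 2 (Fintype.card ((Fin (L * n) → F) × (Fin L → Keys F ℓ))) := by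
      rw [← entropy_uniform]
      refine entropy_congr P _ _ fun ws ws' => ⟨fun h => ?_, fun h => ?_⟩
      · obtain ⟨h1, h2⟩ := Prod.mk.inj h
        refine Prod.ext h1 (funext fun l => ?_)
        have h3 := congrFun h2 l
        simp only [T, h1] at h3
        exact add_right_cancel h3
      · simp only [id] at h
        rw [h]
    rw [Fintype.card_prod, Nat.cast_mul, Real.logb_mul (Nat.cast_ne_zero.2 Fintype.card_ne_zero)
      (Nat.cast_ne_zero.2 Fintype.card_ne_zero)] at h1
    have h2 := entropy_eq_of_pair P (fun ws => ws.1) T h1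
    change mutualInfo P (fun ws => ws.1) T ≤ 0
    rw [mutualInfo, h1, h2.1, h2.2]
    simp

theorem isSecureGroupcast_blockScheme {Q : Set ℕ} (hQ : Fintype.card F ∈ Q) (c : Reliability)
    (hdec : ∀ k : Fin K, (k : ℕ) < N →
      ∀ w w' s s', f w s = f w' s' → view k s = view k s' → w = w')
    (hsec : ∀ e : Fin K, N ≤ (e : ℕ) → ∃ shift : (Fin n → F) → Keys F ℓ, ∀ w s,
      f w s = f 0 (s + shift w) ∧ view e (s + shift w) = view e s) :
    IsSecureGroupcast N Q c (blockScheme f) where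
  fieldSize := fun _ _ => hQ
  correct := fun k hk => by
    choose d hd using fun L => blockScheme_exists_errorProb_eq_zero f (L := L) k (hdec k hk)
    cases c with
    | vanishingError => exact ⟨d, by simp [hd]⟩
    | vanishingEquivocation =>
      refine (isLittleO_natCast_iff fun L => (blockScheme f L).equivocation_nonneg k).2
        fun ε hε => ?_
      -- At zero error Fano's inequality still leaves the constant 1, which is `o(L)`.
      filter_upwards [eventually_le_mul_natCast 1 hε, eventually_gt_atTop 0] with L h1 h2
      have := (blockScheme f L).equivocation_le h2 k (d L)
      rw [hd, zero_mul, add_zero] at this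
      exact this.trans h1
  secure := fun e he => by
    simp [blockScheme_leakage_eq_zero f e (hsec e he)]

end BlockScheme

/-! ### The one-time pad for two qualified receivers and two eavesdroppers -/

section FourReceivers

variable {F : Type} [Field F] {ℓ : KeySet 4 → ℕ}

/-- The set `{q}`. -/
abbrev solo (q : Fin 4) : KeySet 4 := ⟨{q}, Finset.singleton_nonempty q⟩

/-- The set `{q, e}`. -/
abbrev duo (q e : Fin 4) : KeySet 4 := ⟨{q, e}, Finset.insert_nonempty q _⟩

/-- The set of both qualified receivers and `e`. -/
abbrev trio (e : Fin 4) : KeySet 4 := ⟨{0, 1, e}, Finset.insert_nonempty 0 _⟩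

/-- Symbol `j` of the key `s_U`, or `0` if there is none. -/
def keySymbol (s : Keys F ℓ) (U : KeySet 4) (j : ℕ) : F :=
  if h : j < ℓ U then s U ⟨j, h⟩ else 0

/-- Symbol `j` of `w`, or `0` if there is none. -/
def messageSymbol {n : ℕ} (w : Fin n → F) (j : ℕ) : F := if h : j < n then w ⟨j, h⟩ else 0

/-- Symbol `j` of the concatenation of the keys of `{0, 1, e}` and `{q, e}`. -/
def sharedSymbol (s : Keys F ℓ) (q e : Fin 4) (j : ℕ) : F :=
  if j < ℓ (trio e) then keySymbol s (trio e) j else keySymbol s (duo q e) (j - ℓ (trio e))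

/-- The number of message symbols that Receiver `q` covers by keys shared with eavesdroppers, when
`m` symbols are not covered by the key of `{0, 1}`, and `μ` of these are covered in the same way
for both receivers. -/
def sharedLength (ℓ : KeySet 4 → ℕ) (m μ : ℕ) (q : Fin 4) : ℕ := max (m - ℓ (solo q)) μ

/-- The key that covers the message symbol `j` for Receiver `q`. -/
def pad (m μ : ℕ) (q : Fin 4) (s : Keys F ℓ) (j : ℕ) : F :=
  if j < ℓ (duo 0 1) then keySymbol s (duo 0 1) j
  else if j - ℓ (duo 0 1) < sharedLength ℓ m μ q then
    sharedSymbol s q 2 (j - ℓ (duo 0 1)) + sharedSymbol s q 3 (j - ℓ (duo 0 1))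
  else keySymbol s (solo q) (j - ℓ (duo 0 1) - sharedLength ℓ m μ q)

/-- The first message symbol that is covered by the key of `U`. -/
def padOffset (ℓ : KeySet 4 → ℕ) (m μ : ℕ) (U : KeySet 4) : ℕ :=
  if U = duo 0 1 then 0
  else if U = trio 2 ∨ U = trio 3 then ℓ (duo 0 1)
  else if U = solo 0 then ℓ (duo 0 1) + sharedLength ℓ m μ 0
  else if U = solo 1 then ℓ (duo 0 1) + sharedLength ℓ m μ 1
  -- Meant for the sets {q, 2} and {q, 3}, whose keys follow the triple keys. The other sets ending
  -- up here enter no pad, so their value is immaterial.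
  else if 2 ∈ U.1 then ℓ (duo 0 1) + ℓ (trio 2)
  else ℓ (duo 0 1) + ℓ (trio 3)

/-- A change of the keys, invisible for Receiver `e`, that changes each pad by `w`. -/
def padShift (m μ : ℕ) {n : ℕ} (e : Fin 4) (w : Fin n → F) : Keys F ℓ :=
  fun U i => if e ∈ U.1 then 0 else messageSymbol w (i + padOffset ℓ m μ U)

variable {m μ : ℕ}

theorem keySymbol_add_padShift {n : ℕ} (e : Fin 4) (w : Fin n → F) (s : Keys F ℓ)
    (U : KeySet 4) {j : ℕ} (hj : j < ℓ U) :
    keySymbol (s + padShift m μ e w) U j =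
      keySymbol s U j + if e ∈ U.1 then 0 else messageSymbol w (j + padOffset ℓ m μ U) := by
  simp [keySymbol, hj, padShift]

theorem sharedSymbol_add_padShift {n : ℕ} {q e e' : Fin 4} (hq : q = 0 ∨ q = 1)
    (he : e = 2 ∨ e = 3) (he' : e' = 2 ∨ e' = 3) (w : Fin n → F) (s : Keys F ℓ) {j : ℕ}
    (hj : j < ℓ (duo q e') + ℓ (trio e')) :
    sharedSymbol (s + padShift m μ e w) q e' j =
      sharedSymbol s q e' j + if e = e' then 0 else messageSymbol w (j + ℓ (duo 0 1)) := by
  have h1 : padOffset ℓ m μ (trio e') = ℓ (duo 0 1) := by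
    rcases he' with rfl | rfl <;> rfl
  have h2 : padOffset ℓ m μ (duo q e') = ℓ (duo 0 1) + ℓ (trio e') := by
    rcases hq with rfl | rfl <;> rcases he' with rfl | rfl <;> rfl
  have h3 : e ∈ (trio e').1 ↔ e = e' := by
    rcases he with rfl | rfl <;> rcases he' with rfl | rfl <;> decide
  have h4 : e ∈ (duo q e').1 ↔ e = e' := by
    rcases hq with rfl | rfl <;> rcases he with rfl | rfl <;> rcases he' with rfl | rfl <;> decide
  unfold sharedSymbol
  split_ifs with h h' h'
  · rw [keySymbol_add_padShift e w s _ h, if_pos (h3.2 h')]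
  · rw [keySymbol_add_padShift e w s _ h, if_neg (mt h3.1 h'), h1]
  · rw [keySymbol_add_padShift e w s _ (by omega), if_pos (h4.2 h')]
  · rw [keySymbol_add_padShift e w s _ (by omega), if_neg (mt h4.1 h'), h2]
    congr 2
    omega

/-- Each key symbol is tied to one message symbol, the same for both receivers if the key is common,
so a single shift corrects all pads at once. The bounds on `m` and `μ` ensure that no pad symbol in
range is a default 0. -/
theorem pad_add_padShift {n : ℕ} {q e : Fin 4} (hq : q = 0 ∨ q = 1) (he : e = 2 ∨ e = 3)
    (hμ : ∀ e', e' = 2 ∨ e' = 3 → μ ≤ ℓ (trio e'))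
    (hm : ∀ e', e' = 2 ∨ e' = 3 → m ≤ ℓ (solo q) + ℓ (duo q e') + ℓ (trio e'))
    (w : Fin n → F) (s : Keys F ℓ) {j : ℕ} (hj : j < ℓ (duo 0 1) + m) :
    pad m μ q (s + padShift m μ e w) j = messageSymbol w j + pad m μ q s j := by
  have hlen : ∀ e', e' = 2 ∨ e' = 3 → sharedLength ℓ m μ q ≤ ℓ (duo q e') + ℓ (trio e') := by
    intro e' he'
    have := hμ e' he'
    have := hm e' he'
    exact max_le (by omega) (by omega)
  have hsolo : m ≤ sharedLength ℓ m μ q + ℓ (solo q) := by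
    have : m - ℓ (solo q) ≤ sharedLength ℓ m μ q := le_max_left _ _
    omega
  unfold pad
  split_ifs with h1 h2
  · have h : e ∉ (duo 0 1).1 := by rcases he with rfl | rfl <;> decide
    rw [keySymbol_add_padShift e w s _ h1, if_neg h, add_comm]
    rfl
  · have h3 := hlen 2 (Or.inl rfl)
    have h4 := hlen 3 (Or.inr rfl)
    rw [sharedSymbol_add_padShift hq he (Or.inl rfl) w s (by omega),
      sharedSymbol_add_padShift hq he (Or.inr rfl) w s (by omega),
      Nat.sub_add_cancel (not_lt.1 h1)]
    -- Of the two summands, the one known to `e` stays fixed and the other absorbs the message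
    -- symbol.
    rcases he with rfl | rfl
    · rw [if_pos rfl, if_neg (by decide)]
      ring
    · rw [if_neg (by decide), if_pos rfl]
      ring
  · have h : e ∉ (solo q).1 := by
      rcases hq with rfl | rfl <;> rcases he with rfl | rfl <;> decide
    have h3 : padOffset ℓ m μ (solo q) = ℓ (duo 0 1) + sharedLength ℓ m μ q := by
      rcases hq with rfl | rfl <;> rfl
    rw [keySymbol_add_padShift e w s _ (by omega), if_neg h, h3, add_comm]
    congr 2
    omega

theorem keySymbol_congr {q : Fin 4} {s s' : Keys F ℓ} (h : view q s = view q s') {U : KeySet 4}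
    (hU : q ∈ U.1) (j : ℕ) : keySymbol s U j = keySymbol s' U j := by
  have : s U = s' U := congrFun h ⟨U, hU⟩
  simp [keySymbol, this]

theorem pad_congr {q : Fin 4} (hq : q = 0 ∨ q = 1) {s s' : Keys F ℓ} (h : view q s = view q s')
    (j : ℕ) : pad m μ q s j = pad m μ q s' j := by
  have h1 : q ∈ (duo 0 1).1 := by rcases hq with rfl | rfl <;> decide
  have h2 : ∀ e, q ∈ (trio e).1 := by rcases hq with rfl | rfl <;> decide
  have h3 : ∀ e, q ∈ (duo q e).1 := by simp
  have h4 : q ∈ (solo q).1 := by simp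
  simp only [pad, sharedSymbol, keySymbol_congr h h1, keySymbol_congr h (h2 _),
    keySymbol_congr h (h3 _), keySymbol_congr h h4]

/-- In this range the pad comes from the key of {0, 1} or from the two triple keys, none of which
depends on the receiver. The maximum in `sharedLength` excludes the single-receiver keys here. -/
theorem pad_eq_pad (hμ : ∀ e', e' = 2 ∨ e' = 3 → μ ≤ ℓ (trio e')) (s : Keys F ℓ) {j : ℕ}
    (hj : j < ℓ (duo 0 1) + μ) (q q' : Fin 4) : pad m μ q s j = pad m μ q' s j := by
  unfold pad
  split_ifs with h1 h2 h3 h3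
  · rfl
  · have := hμ 2 (Or.inl rfl)
    have := hμ 3 (Or.inr rfl)
    simp only [sharedSymbol]
    rw [if_pos (by omega), if_pos (by omega), if_pos (by omega), if_pos (by omega)]
  · exact absurd (lt_of_lt_of_le (by omega) (le_max_right _ _)) h3
  · exact absurd (lt_of_lt_of_le (by omega) (le_max_right _ _)) h2
  · exact absurd (lt_of_lt_of_le (by omega) (le_max_right _ _)) h2

/-- The message, covered for Receiver `0`, and its symbols from `ℓ (duo 0 1) + μ` on, covered for
Receiver `1`. -/
def groupcastEncode (ℓ : KeySet 4 → ℕ) (m μ : ℕ) (w : Fin (ℓ (duo 0 1) + m) → F) (s : Keys F ℓ) :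
    Fin ((ℓ (duo 0 1) + m) + (m - μ)) → F :=
  Fin.append (fun j => messageSymbol w j + pad m μ 0 s j)
    (fun j => messageSymbol w (j + (ℓ (duo 0 1) + μ)) + pad m μ 1 s (j + (ℓ (duo 0 1) + μ)))

theorem groupcastEncode_eq_iff (w w' : Fin (ℓ (duo 0 1) + m) → F) (s s' : Keys F ℓ) :
    groupcastEncode ℓ m μ w s = groupcastEncode ℓ m μ w' s' ↔
      (∀ j < ℓ (duo 0 1) + m, messageSymbol w j + pad m μ 0 s j =
        messageSymbol w' j + pad m μ 0 s' j) ∧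
      ∀ j < ℓ (duo 0 1) + m, ℓ (duo 0 1) + μ ≤ j → messageSymbol w j + pad m μ 1 s j =
        messageSymbol w' j + pad m μ 1 s' j := by
  constructor
  · intro h
    refine ⟨fun j hj => ?_, fun j hj hj' => ?_⟩
    · have := congrFun h (Fin.castAdd _ ⟨j, hj⟩)
      simpa only [groupcastEncode, Fin.append_left] using this
    · have := congrFun h (Fin.natAdd _ ⟨j - (ℓ (duo 0 1) + μ), by omega⟩)
      simpa only [groupcastEncode, Fin.append_right, Nat.sub_add_cancel hj'] using this
  · rintro ⟨h1, h2⟩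
    unfold groupcastEncode
    congr 1
    · exact funext fun j => h1 j j.2
    · exact funext fun j => h2 _ (by omega) (by omega)

theorem groupcastEncode_decodable (hμ : ∀ e', e' = 2 ∨ e' = 3 → μ ≤ ℓ (trio e')) (k : Fin 4)
    (hk : (k : ℕ) < 2) (w w' : Fin (ℓ (duo 0 1) + m) → F) (s s' : Keys F ℓ)
    (h : groupcastEncode ℓ m μ w s = groupcastEncode ℓ m μ w' s') (hv : view k s = view k s') :
    w = w' := by
  obtain ⟨h1, h2⟩ := (groupcastEncode_eq_iff w w' s s').1 h
  have hk' : k = 0 ∨ k = 1 := by omega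
  have hp := fun j => pad_congr (m := m) (μ := μ) hk' hv j
  have hw : ∀ j < ℓ (duo 0 1) + m, messageSymbol w j = messageSymbol w' j := by
    intro j hj
    rcases hk' with rfl | rfl
    · have := h1 j hj
      rwa [hp, add_left_inj] at this
    · by_cases hj' : ℓ (duo 0 1) + μ ≤ j
      · have := h2 j hj hj'
        rwa [hp, add_left_inj] at this
      -- Receiver `1` reads these symbols from the part of the signal made for Receiver `0`, as the
      -- pads agree.
      · have := h1 j hj
        rwa [pad_eq_pad hμ s (not_le.1 hj') 0 1, pad_eq_pad hμ s' (not_le.1 hj') 0 1, hp,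
          add_left_inj] at this
  funext j
  simpa [messageSymbol] using hw j j.2

theorem groupcastEncode_secure (hμ : ∀ e', e' = 2 ∨ e' = 3 → μ ≤ ℓ (trio e'))
    (hm : ∀ q, q = 0 ∨ q = 1 → ∀ e', e' = 2 ∨ e' = 3 →
      m ≤ ℓ (solo q) + ℓ (duo q e') + ℓ (trio e')) (e : Fin 4) (he : 2 ≤ (e : ℕ)) :
    ∃ shift : (Fin (ℓ (duo 0 1) + m) → F) → Keys F ℓ, ∀ w s,
      groupcastEncode ℓ m μ w s = groupcastEncode ℓ m μ 0 (s + shift w) ∧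
        view e (s + shift w) = view e s := by
  have he' : e = 2 ∨ e = 3 := by omega
  have h0 : ∀ j, messageSymbol (0 : Fin (ℓ (duo 0 1) + m) → F) j = 0 := by
    simp [messageSymbol]
  refine ⟨padShift m μ e, fun w s => ⟨?_, ?_⟩⟩
  · rw [groupcastEncode_eq_iff]
    refine ⟨fun j hj => ?_, fun j hj _ => ?_⟩
    · rw [pad_add_padShift (Or.inl rfl) he' hμ (hm 0 (Or.inl rfl)) w s hj, h0, zero_add]
    · rw [pad_add_padShift (Or.inr rfl) he' hμ (hm 1 (Or.inr rfl)) w s hj, h0, zero_add]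
  · funext U i
    simp [view, padShift, U.2]

theorem keyLength_qualified (ℓ : KeySet 4 → ℕ) :
    keyLength ℓ (fun U => (0 : Fin 4) ∈ U.1 ∧ (2 : Fin 4) ∉ U.1) =
      ℓ (duo 0 1) + (ℓ (solo 0) + ℓ (duo 0 3) + ℓ (trio 3)) ∧
    keyLength ℓ (fun U => (0 : Fin 4) ∈ U.1 ∧ (3 : Fin 4) ∉ U.1) =
      ℓ (duo 0 1) + (ℓ (solo 0) + ℓ (duo 0 2) + ℓ (trio 2)) ∧
    keyLength ℓ (fun U => (1 : Fin 4) ∈ U.1 ∧ (2 : Fin 4) ∉ U.1) =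
      ℓ (duo 0 1) + (ℓ (solo 1) + ℓ (duo 1 3) + ℓ (trio 3)) ∧
    keyLength ℓ (fun U => (1 : Fin 4) ∈ U.1 ∧ (3 : Fin 4) ∉ U.1) =
      ℓ (duo 0 1) + (ℓ (solo 1) + ℓ (duo 1 2) + ℓ (trio 2)) := by
  have key : ∀ (T : KeySet 4 → Prop) [DecidablePred T] (a b c d : KeySet 4),
      [a, b, c, d].Nodup → Finset.univ.filter T = {a, b, c, d} →
      keyLength ℓ T = ℓ a + (ℓ b + ℓ c + ℓ d) := by
    intro T _ a b c d hnd hT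
    rw [keyLength, ← Finset.sum_filter, hT]
    simp only [List.nodup_cons, List.mem_cons, not_or] at hnd
    rw [Finset.sum_insert (by simp; tauto), Finset.sum_insert (by simp; tauto),
      Finset.sum_insert (by simp; tauto), Finset.sum_singleton]
    ring
  exact ⟨key _ _ _ _ _ (by decide) (by decide), key _ _ _ _ _ (by decide) (by decide),
    key _ _ _ _ _ (by decide) (by decide), key _ _ _ _ _ (by decide) (by decide)⟩

theorem keyLength_common (ℓ : KeySet 4 → ℕ) :
    keyLength ℓ (fun U => (0 : Fin 4) ∈ U.1 ∧ (1 : Fin 4) ∈ U.1 ∧ (2 : Fin 4) ∉ U.1) =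
      ℓ (duo 0 1) + ℓ (trio 3) ∧
    keyLength ℓ (fun U => (0 : Fin 4) ∈ U.1 ∧ (1 : Fin 4) ∈ U.1 ∧ (3 : Fin 4) ∉ U.1) =
      ℓ (duo 0 1) + ℓ (trio 2) := by
  have key : ∀ (T : KeySet 4 → Prop) [DecidablePred T] (a b : KeySet 4), a ≠ b →
      Finset.univ.filter T = {a, b} → keyLength ℓ T = ℓ a + ℓ b := by
    intro T _ a b hab hT
    rw [keyLength, ← Finset.sum_filter, hT, Finset.sum_pair hab]
  exact ⟨key _ _ _ (by decide) (by decide), key _ _ _ (by decide) (by decide)⟩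

end FourReceivers

/-! ### Capacity and minimum bandwidth -/

theorem theorem5 (F : Type) [Field F] [Fintype F] (ℓ : KeySet 4 → ℕ)
    (Q : Set ℕ) (hQ : Fintype.card F ∈ Q) (c : Reliability) :
    ∃ C : ℝ, IsCapacity 2 F ℓ Q c C ∧
      C = min (min (viewCondEntropy F ℓ 0 2) (viewCondEntropy F ℓ 0 3))
            (min (viewCondEntropy F ℓ 1 2) (viewCondEntropy F ℓ 1 3)) ∧
      C = keyEntropy F ℓ {0, 1} +
          min
            (min (keyEntropy F ℓ {0} + keyEntropy F ℓ {0, 3} + keyEntropy F ℓ {0, 1, 3})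
              (keyEntropy F ℓ {0} + keyEntropy F ℓ {0, 2} + keyEntropy F ℓ {0, 1, 2}))
            (min (keyEntropy F ℓ {1} + keyEntropy F ℓ {1, 3} + keyEntropy F ℓ {0, 1, 3})
              (keyEntropy F ℓ {1} + keyEntropy F ℓ {1, 2} + keyEntropy F ℓ {0, 1, 2})) ∧
      IsMinBandwidth 2 F ℓ Q c C
        (2 * C - keyEntropy F ℓ {0, 1} -
          min (keyEntropy F ℓ {0, 1, 2}) (keyEntropy F ℓ {0, 1, 3})) := by
  set m : ℕ := min (min (ℓ (solo 0) + ℓ (duo 0 3) + ℓ (trio 3))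
      (ℓ (solo 0) + ℓ (duo 0 2) + ℓ (trio 2)))
    (min (ℓ (solo 1) + ℓ (duo 1 3) + ℓ (trio 3)) (ℓ (solo 1) + ℓ (duo 1 2) + ℓ (trio 2))) with hm
  set μ : ℕ := min (ℓ (trio 2)) (ℓ (trio 3)) with hμ
  set b : ℝ := Real.logb 2 (Fintype.card F) with hb
  have hb0 : 0 ≤ b := Real.logb_nonneg one_lt_two (by exact_mod_cast Fintype.card_pos)
  -- Every term of the minimum `m` contains a triple key; hence `m - μ` in the signal length is not
  -- truncated.
  have hμm : μ ≤ m := by omega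
  have hμ' : ∀ e', e' = 2 ∨ e' = 3 → μ ≤ ℓ (trio e') := by
    rintro _ (rfl | rfl)
    exacts [min_le_left _ _, min_le_right _ _]
  have hm' : ∀ q, q = 0 ∨ q = 1 → ∀ e', e' = 2 ∨ e' = 3 →
      m ≤ ℓ (solo q) + ℓ (duo q e') + ℓ (trio e') := by
    rintro _ (rfl | rfl) _ (rfl | rfl) <;> omega
  have hscheme : IsSecureGroupcast 2 Q c (blockScheme (groupcastEncode (F := F) ℓ m μ)) :=
    isSecureGroupcast_blockScheme _ hQ c (groupcastEncode_decodable hμ')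
      (groupcastEncode_secure hμ' hm')
  obtain ⟨k1, k2, k3, k4⟩ := keyLength_qualified ℓ
  obtain ⟨k5, k6⟩ := keyLength_common ℓ
  have hC : ((ℓ (duo 0 1) + m : ℕ) : ℝ) * b =
      min (min (viewCondEntropy F ℓ 0 2) (viewCondEntropy F ℓ 0 3))
        (min (viewCondEntropy F ℓ 1 2) (viewCondEntropy F ℓ 1 3)) := by
    rw [viewCondEntropy_eq, viewCondEntropy_eq, viewCondEntropy_eq, viewCondEntropy_eq,
      k1, k2, k3, k4, ← min_mul_of_nonneg _ _ hb0, ← min_mul_of_nonneg _ _ hb0,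
      ← min_mul_of_nonneg _ _ hb0, ← Nat.cast_min, ← Nat.cast_min, ← Nat.cast_min,
      min_add_add_left, min_add_add_left, min_add_add_left]
  have hmin : (μ : ℝ) * b = min (keyEntropy F ℓ {0, 1, 2}) (keyEntropy F ℓ {0, 1, 3}) := by
    rw [keyEntropy_eq, keyEntropy_eq, ← min_mul_of_nonneg _ _ hb0, ← Nat.cast_min]
  refine ⟨((ℓ (duo 0 1) + m : ℕ) : ℝ) * b, ?_, hC, ?_, ?_⟩
  · refine IsGreatest.isLUB ⟨⟨_, hscheme, fun L hL => (blockScheme_rate _ hL).ge⟩, fun R hR => ?_⟩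
    rw [hC]
    refine le_min (le_min ?_ ?_) (le_min ?_ ?_) <;>
      exact hR.le_viewCondEntropy _ _ (by decide) (by decide)
  · simp only [keyEntropy_eq, ← hb, ← add_mul]
    rw [← min_mul_of_nonneg _ _ hb0, ← min_mul_of_nonneg _ _ hb0,
      ← min_mul_of_nonneg _ _ hb0, ← add_mul, hm]
    push_cast
    rfl
  · rw [← hmin, keyEntropy_eq, ← hb]
    refine IsLeast.isGLB ⟨⟨_, hscheme, fun L hL => ⟨(blockScheme_rate _ hL).ge, ?_⟩⟩,
      fun β hβ => ?_⟩
    · rw [blockScheme_bandwidth _ hL, ← hb]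
      push_cast [Nat.cast_sub hμm]
      exact le_of_eq (by ring)
    · have h2 := hβ.two_mul_le 0 1 2 (by decide) (by decide) (by decide)
      have h3 := hβ.two_mul_le 0 1 3 (by decide) (by decide) (by decide)
      rw [k5, ← hb] at h2
      rw [k6, ← hb] at h3
      push_cast at h2 h3 ⊢
      -- Eavesdropper `2` gives the bound with `trio 3` and eavesdropper `3` that with `trio 2`; the
      -- shorter key gives the stronger bound.
      rcases min_choice (ℓ (trio 2)) (ℓ (trio 3)) with h | h
      · rw [hμ, h]
        linarith
      · rw [hμ, h]
        linarith
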